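/- Let $H_6$ be the 2-coloured graph on $\{0,1,2,3\}$ with the red edge $02$ and the blue edges $01,03,13$. An embedding of a 2-coloured graph $H$ on $\kappa$ vertices into a graph $G$ is an injection $V(H)\to V(G)$ that sends red edges to edges and blue edges to non-edges. For a graph $G$ of order $n\ge\kappa$ let $\lambda_H(G)$ be the number of embeddings of $H$ into $G$ divided by $n(n-1)\cdots(n-\kappa+1)$, let $\lambda_H(n)$ be the maximum of $\lambda_H(G)$ over all graphs $G$ of order $n$, and let $\lambda_H:=\lim_{n\to\infty}\lambda_H(n)$ be the semi-inducibility constant of $H$. A sequence of graphs $(G_i)$ with orders tending to infinity is almost extremal if $\lambda_H(G_i)=\lambda_H+o(1)$ as $i\to\infty$. A complete bipartite graph is a graph whose vertex set has a partition into two parts, one of which may be empty, such that two vertices are adjacent if and only if they lie in different parts. A flag algebra certificate with parameter $N\ge\kappa$ for the bound $\lambda_H\le u$ consists of real numbers $c_F\ge0$ for all graphs $F$ on $\{1,\dots,N\}$ and, for all integers $k,l\ge 0$ with $k+2l\le N$, a real positive semidefinite matrix $Q^{(k,l)}$ indexed by the graphs on $\{1,\dots,k+l\}$, such that for every graph $F$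 on $\{1,\dots,N\}$ \[ u-\lambda_H(F)=\sum_{k+2l\le N}\mathbb E\left[Q^{(k,l)}_{F[\mathbf x,\mathbf y],\,F[\mathbf x,\mathbf z]}\right]+c_F , \] where $\mathbf x\in V(F)^k$ and $\mathbf y,\mathbf z\in V(F)^l$ together form a uniformly random sequence of $k+2l$ distinct vertices, and $F[\mathbf x,\mathbf y]$ is the graph on $\{1,\dots,k+l\}$ in which $i,j$ are adjacent if and only if the $i$-th and the $j$-th vertex of the sequence $(\mathbf x,\mathbf y)$ are adjacent in $F$. Then the following hold. 1. The limit $\lambda_{H_6}$ exists and equals $1/8$. 2. The bound $\lambda_{H_6}\le 1/8$ has a flag algebra certificate with $N=5$. 3. The value $1/8$ is asymptotically attained by balanced complete bipartite graphs: if $G_n$ is a complete bipartite graph of order $n$ both of whose parts have size $(1/2+o(1))n$, then $\lambda_{H_6}(G_n)\to 1/8$ as $n\to\infty$. 4. Let $(G_i)$ be an almost extremal sequence for $H_6$ and let $F$ be a graph with $5$ vertices. If there is $\delta>0$ such that, for infinitely many $i$, at least a $\delta$ proportion of the $5$-subsets of $V(G_i)$ induce a subgraph isomorphic to $F$, then $F$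 is complete bipartite or is obtained from a $4$-vertex complete bipartite graph by adding one isolated vertex. -/

import Mathlib

open Filter Topology

/-- A graph on `V` whose edges are coloured red or blue (no pair gets both colours). -/
structure TwoColouredGraph (V : Type*) where
  red : SimpleGraph V
  blue : SimpleGraph V
  disjoint : Disjoint red blue

namespace SemiInducibility

/-- An injection is an embedding of `H` into `G` if it sends red edges to edges and blue edges
to non-edges. -/
def IsEmbedding {V W : Type*} (H : TwoColouredGraph V) (G : SimpleGraph W) (f : V ↪ W) : Prop :=
  (∀ u v, H.red.Adj u v → G.Adj (f u) (f v)) ∧ (∀ u v, H.blue.Adj u v → ¬ G.Adj (f u) (f v))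

open scoped Classical in
/-- The number `Λ_H(G)` of embeddings of `H` into `G`. -/
noncomputable def embCount {V W : Type*} [Fintype V] [Fintype W]
    (H : TwoColouredGraph V) (G : SimpleGraph W) : ℕ :=
  (Finset.univ.filter (fun f : V ↪ W => IsEmbedding H G f)).card

/-- The normalised count `λ_H(G) = Λ_H(G) / n^{(κ)}`, where `n` is the order of `G`, `κ` is the
order of `H` and `n^{(κ)} = n(n-1)⋯(n-κ+1)`; meaningful for `n ≥ κ`. -/
noncomputable def embDensity {V W : Type*} [Fintype V] [Fintype W]
    (H : TwoColouredGraph V) (G : SimpleGraph W) : ℝ :=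
  (embCount H G : ℝ) / ((Fintype.card W).descFactorial (Fintype.card V) : ℝ)

open scoped Classical in
/-- `Λ_H(n)`: the maximum of `Λ_H(G)` over all graphs `G` of order `n`. -/
noncomputable def maxEmbCount {V : Type*} [Fintype V] (H : TwoColouredGraph V) (n : ℕ) : ℕ :=
  (Finset.univ : Finset (SimpleGraph (Fin n))).sup (fun G => embCount H G)

/-- `λ_H(n) = Λ_H(n) / n^{(κ)}`; meaningful for `n ≥ κ`. -/
noncomputable def maxEmbDensity {V : Type*} [Fintype V] (H : TwoColouredGraph V) (n : ℕ) : ℝ :=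
  (maxEmbCount H n : ℝ) / (n.descFactorial (Fintype.card V) : ℝ)

/-- `c` is the semi-inducibility constant `λ_H = lim_{n → ∞} λ_H(n)` (the limit exists and
equals `c`). -/
def HasSemiInducibilityConstant {V : Type*} [Fintype V] (H : TwoColouredGraph V) (c : ℝ) : Prop :=
  Tendsto (fun n : ℕ => maxEmbDensity H n) atTop (𝓝 c)

/-- A sequence of graphs of orders tending to infinity is almost extremal for `H` if
`λ_H(G_i) = λ_H + o(1)`. -/
def IsAlmostExtremal {V : Type*} [Fintype V] (H : TwoColouredGraph V)
    {n : ℕ → ℕ} (G : (i : ℕ) → SimpleGraph (Fin (n i))) : Prop :=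
  Tendsto n atTop atTop ∧
    ∃ c : ℝ, HasSemiInducibilityConstant H c ∧
      Tendsto (fun i => embDensity H (G i)) atTop (𝓝 c)

open scoped Classical in
/-- The induced density `p(F,G)`: the proportion of `v(F)`-subsets of the vertex set of `G` that
induce a subgraph isomorphic to `F`. -/
noncomputable def inducedDensity {V W : Type*} [Fintype V] [Fintype W]
    (F : SimpleGraph V) (G : SimpleGraph W) : ℝ :=
  (((Finset.univ : Finset W).powersetCard (Fintype.card V)).filter
      (fun X => Nonempty (G.induce (X : Set W) ≃g F))).card /
    ((Fintype.card W).choose (Fintype.card V) : ℝ)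

/-- The blowup of `B` in which the vertex `x` lies in the part indexed by `part x`: vertices are
adjacent iff their parts are adjacent in `B`. Parts may be empty. -/
def blowup {I V : Type*} (B : SimpleGraph I) (part : V → I) : SimpleGraph V :=
  SimpleGraph.comap part B

/-- Complete bipartite graphs `T_{a,b}`, that is, blowups of `K_2`; as usual for blowups, `a = 0`
or `b = 0` is allowed (which gives the graphs without edges). -/
def IsCompleteBipartite {V : Type*} (G : SimpleGraph V) : Prop :=
  ∃ part : V → Fin 2, G = blowup (⊤ : SimpleGraph (Fin 2)) part

/-- `G` consists of an isolated vertex `v` and a complete bipartite graph on the other vertices. -/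
def IsCompleteBipartiteAddIsolated {V : Type*} (G : SimpleGraph V) : Prop :=
  ∃ v : V, (∀ u, ¬ G.Adj v u) ∧ IsCompleteBipartite (G.induce {u | u ≠ v})

/-! ### Flag algebra certificates -/

open scoped Classical in
/-- Ordered pairs of `(k+l)`-vertex flags inside an `N`-set that share their `k` labelled roots
(in the same order, the first `k` indices) and are otherwise disjoint. -/
noncomputable def flagPairs (N k l : ℕ) :
    Finset ((Fin (k + l) ↪ Fin N) × (Fin (k + l) ↪ Fin N)) :=
  Finset.univ.filter (fun e => ∀ i j, e.1 i = e.2 j ↔ i = j ∧ (i : ℕ) < k)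

/-- The coefficient at `F` of the sum of squares given by the matrix `Q`: the expectation of
`Q(F₁, F₂)` where `F₁, F₂` are the two flags spanned in `F` by a uniformly random pair of
`(k+l)`-sets sharing exactly `k` ordered roots. Both flags have the same type, i.e. they induce
the same graph on the roots, so only the diagonal blocks of `Q`, one for each type, are used. -/
noncomputable def sosCoeff {N : ℕ} (k l : ℕ)
    (Q : Matrix (SimpleGraph (Fin (k + l))) (SimpleGraph (Fin (k + l))) ℝ)
    (F : SimpleGraph (Fin N)) : ℝ :=
  (∑ e ∈ flagPairs N k l, Q (SimpleGraph.comap e.1 F) (SimpleGraph.comap e.2 F)) /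
    ((flagPairs N k l).card : ℝ)

/-- There is a flag algebra certificate on `N` vertices for the bound `λ_H ≤ u`: non-negative
slacks `c_F` and positive semidefinite matrices such that, for every graph `F` of order `N`, the
coefficient at `F` of `u - λ_H` is that of the sum of squares plus `c_F`. The sum is over all
numbers `k` of roots and `l` of unlabelled vertices for which two flags fit into `N` vertices. -/
def HasFlagCertificate {V : Type*} [Fintype V] (H : TwoColouredGraph V) (N : ℕ) (u : ℝ) : Prop :=
  Fintype.card V ≤ N ∧
  ∃ (c : SimpleGraph (Fin N) → ℝ)
    (Q : (k l : ℕ) → Matrix (SimpleGraph (Fin (k + l))) (SimpleGraph (Fin (k + l))) ℝ),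
    (∀ F, 0 ≤ c F) ∧ (∀ k l, (Q k l).PosSemidef) ∧
    ∀ F : SimpleGraph (Fin N),
      u - embDensity H F =
        (∑ kl ∈ (Finset.range (N + 1) ×ˢ Finset.range (N + 1)).filter
            (fun kl : ℕ × ℕ => kl.1 + 2 * kl.2 ≤ N),
          sosCoeff kl.1 kl.2 (Q kl.1 kl.2) F) + c F

/-- The 2-coloured graph on `{0,1,2,3}` with the red edge `02` and the blue edges `01, 03, 13`. -/
def H6 : TwoColouredGraph (Fin 4) where
  red := SimpleGraph.fromEdgeSet {s(0, 2)}
  blue := SimpleGraph.fromEdgeSet {s(0, 1), s(0, 3), s(1, 3)}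
  disjoint := by
    rw [SimpleGraph.disjoint_fromEdgeSet, Set.disjoint_left]
    intro e he
    simp only [SimpleGraph.edgeSet_fromEdgeSet, Set.mem_sdiff, Set.mem_singleton_iff,
      Set.mem_insert_iff] at he ⊢
    rintro (⟨h, -⟩ | ⟨h, -⟩)
    all_goals revert he; decide +revert

end SemiInducibility

/-! The upper bound is a sum-of-squares argument on five vertices, scaled by 216 so that all weights
are integers. To 216 times the indicator that `(b, c, d, e)` is an embedding, `certTerm` adds three
products. Summed over all quintuples they become squares: one over a root `a` (`rootFlag`), two over
triples `a, b, c` whose only edge is `ab` (`antiFlag`, `symFlag`).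

Both kinds of square vanish on balanced complete bipartite graphs. There no triple spans exactly one
edge, and the root sum is `3 * (x - y) ^ 2` for parts of sizes `x` and `y`.

The finite core is `codeSum_cases`: over the 120 orderings of a five-vertex graph the terms add up
to at most 3240 = 120 * 216 / 8, and equality forces the graph to be tight (`IsTight`). This is used
twice. Read on five vertices, it says that the slacks of the flag certificate are non-negative. In a
graph of order `n`, the sum over all quintuples, repetitions allowed, is a sum of genuine squares
(`sum_squareTerm_nonneg`), and the quintuples with repetitions are negligible. Hence the density is
at most 1/8 + o(1) minus a multiple of the proportion of non-tight quintuples (`embDensity_H6_le`),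
which yields both the limit and the stability statement.

For the lower bound, `a`, `b`, `d` lie in one part and `c` in the other, giving 2 * (1/2)^4 = 1/8.
-/

namespace SemiInducibility

/-! ### Integer weights of the certificate -/

/-- The weight of the flag with one root and two further vertices: `p`, `q` tell whether these are
adjacent to the root and `r` whether they are adjacent to each other. -/
def rootFlag (p q r : Bool) : ℤ :=
  cond p (cond q (cond r (-2) 3) (cond r (-3) (-1))) (cond q (cond r (-3) (-1)) (cond r (-3) 3))

/-- A weight for the flags over three roots spanning one edge, antisymmetric in the ends of the
edge: `p`, `q`, `r` tell whether the further vertex is adjacent to the roots, the isolated one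
last. -/
def antiFlag (p q r : Bool) : ℤ :=
  cond r 0 (cond p (cond q 0 1) (cond q (-1) 0))

/-- A weight for the flags over three roots spanning one edge, symmetric in the ends of the
edge. -/
def symFlag (p q r : Bool) : ℤ :=
  cond r (cond p (-1) (cond q (-1) (-2))) (cond p (cond q 1 0) (cond q 0 1))

/-- Whether `(a, b, c, d)` is an embedding of `H6`. -/
def isEmb {α : Type*} (r : α → α → Bool) (a b c d : α) : Bool :=
  r a c && !r a b && !r a d && !r b d

/-- Whether `ab` is the only edge spanned by `a`, `b`, `c`. -/
def edgeType {α : Type*} (r : α → α → Bool) (a b c : α) : Bool :=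
  r a b && !r a c && !r b c

/-- The contribution of an ordered quintuple to the three squares of the certificate. -/
def squareTerm {α : Type*} (r : α → α → Bool) (a b c d e : α) : ℤ :=
  3 * (rootFlag (r a b) (r a c) (r b c) * rootFlag (r a d) (r a e) (r d e)) +
  cond (edgeType r a b c)
    (144 * (antiFlag (r a d) (r b d) (r c d) * antiFlag (r a e) (r b e) (r c e)) +
      28 * (symFlag (r a d) (r b d) (r c d) * symFlag (r a e) (r b e) (r c e))) 0

/-- The contribution of an ordered quintuple to the certificate. -/
def certTerm {α : Type*} (r : α → α → Bool) (a b c d e : α) : ℤ :=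
  cond (isEmb r b c d e) 216 0 + squareTerm r a b c d e

/-- Here 283 = 3 * 9 + 144 * 1 + 28 * 4 bounds the three products separately. The ten adjacencies
are treated as independent Booleans, so tuples with repeated vertices are covered. -/
theorem squareTerm_le {α : Type*} (r : α → α → Bool) (a b c d e : α) :
    squareTerm r a b c d e ≤ 283 := by
  have h : ∀ x01 x02 x12 x03 x13 x23 : Bool, ∀ x04 x14 x24 x34 : Bool,
      3 * (rootFlag x01 x02 x12 * rootFlag x03 x04 x34) +
      cond (x01 && !x02 && !x12)
      (144 * (antiFlag x03 x13 x23 * antiFlag x04 x14 x24) +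
        28 * (symFlag x03 x13 x23 * symFlag x04 x14 x24)) 0 ≤ 283 := by decide +kernel
  exact h ..

/-! ### Finite check over the graphs of order five -/

/-- Distinct labels for five vertices such that the sums of two different labels are distinct
modulo `11` and take the values `0, …, 9`: they are `0, 1, 2, 4, 7`. -/
def label (i : Fin 5) : ℕ := i + i / 3 + i / 4 * 2

/-- Adjacency of the vertices labelled `x` and `y` in the graph encoded by the bits of `m`. -/
def codeBit (m x y : ℕ) : Bool := m.testBit ((x + y) % 11)

/-- The pair of vertices at each bit position. -/
def bitPair : Fin 10 → Fin 5 × Fin 5 :=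
  ![(3, 4), (0, 1), (0, 2), (1, 2), (0, 3), (1, 3), (2, 3), (0, 4), (1, 4), (2, 4)]

/-- The code of a symmetric relation on five vertices. -/
def code (r : Fin 5 → Fin 5 → Bool) : ℕ := Nat.ofBits fun p => r (bitPair p).1 (bitPair p).2

theorem code_lt (r : Fin 5 → Fin 5 → Bool) : code r < 1024 := Nat.ofBits_lt_two_pow _

/-- The diagonal must be excluded: a doubled label is, modulo 11, the bit position of some pair of
distinct vertices. -/
theorem codeBit_code {r : Fin 5 → Fin 5 → Bool} (hr : ∀ i j, r i j = r j i) {i j : Fin 5}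
    (hij : i ≠ j) : codeBit (code r) (label i) (label j) = r i j := by
  have h : ∀ i j : Fin 5, i ≠ j → ∃ p : Fin 10, (label i + label j) % 11 = p ∧
      (bitPair p = (i, j) ∨ bitPair p = (j, i)) := by decide
  obtain ⟨p, hp, hp'⟩ := h i j hij
  rw [codeBit, hp, code, Nat.testBit_ofBits_lt _ _ p.2]
  rcases hp' with h | h <;> simp [h, hr i j]

/-- The labels of all orderings of the five vertices. -/
def orderings : List (ℕ × ℕ × ℕ × ℕ × ℕ) :=
  let l := [0, 1, 2, 4, 7]
  l.flatMap fun a => (l.filter (· != a)).flatMap fun b =>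
    (l.filter fun x => x != a && x != b).flatMap fun c =>
    (l.filter fun x => x != a && x != b && x != c).flatMap fun d =>
    (l.filter fun x => x != a && x != b && x != c && x != d).map fun e => (a, b, c, d, e)

theorem map_label_univ_perm :
    (Finset.univ : Finset (Equiv.Perm (Fin 5))).val.map (fun σ =>
      (label (σ 0), label (σ 1), label (σ 2), label (σ 3), label (σ 4))) = ↑orderings := by
  decide +kernel

/-- The sum of the certificate terms of the graph with code `m`. -/
def codeSum (m : ℕ) : ℤ :=
  (orderings.map fun t => certTerm (codeBit m) t.1 t.2.1 t.2.2.1 t.2.2.2.1 t.2.2.2.2).sum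

theorem sum_perm_certTerm_eq_codeSum {r : Fin 5 → Fin 5 → Bool} (hr : ∀ i j, r i j = r j i) :
    ∑ σ : Equiv.Perm (Fin 5), certTerm r (σ 0) (σ 1) (σ 2) (σ 3) (σ 4) = codeSum (code r) := by
  have h (σ : Equiv.Perm (Fin 5)) (i j : Fin 5) (hij : i ≠ j) :
      r (σ i) (σ j) = codeBit (code r) (label (σ i)) (label (σ j)) :=
    (codeBit_code hr (σ.injective.ne hij)).symm
  have h2 (σ : Equiv.Perm (Fin 5)) : certTerm r (σ 0) (σ 1) (σ 2) (σ 3) (σ 4) =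
      certTerm (codeBit (code r)) (label (σ 0)) (label (σ 1)) (label (σ 2)) (label (σ 3))
        (label (σ 4)) := by
    simp only [certTerm, isEmb, squareTerm, edgeType]
    rw [h σ 0 1 (by decide), h σ 0 2 (by decide), h σ 0 3 (by decide), h σ 0 4 (by decide),
      h σ 1 2 (by decide), h σ 1 3 (by decide), h σ 1 4 (by decide), h σ 2 3 (by decide),
      h σ 2 4 (by decide), h σ 3 4 (by decide)]
  simp only [h2]
  have h3 := congrArg (fun s : Multiset (ℕ × ℕ × ℕ × ℕ × ℕ) => (s.map fun t =>
    certTerm (codeBit (code r)) t.1 t.2.1 t.2.2.1 t.2.2.2.1 t.2.2.2.2).sum) map_label_univ_perm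
  simpa [codeSum, Multiset.map_map, Function.comp_def] using h3

/-- `part` shows that the relation `r` is that of a complete bipartite graph with parts `0` and `1`
and at most one additional isolated vertex, which has `part` equal to `2`. -/
def IsPartition (r : Fin 5 → Fin 5 → Bool) (part : Fin 5 → Fin 3) : Prop :=
  (∀ i j, i ≠ j → (r i j ↔ part i ≠ part j ∧ part i ≠ 2 ∧ part j ≠ 2)) ∧
    ∀ i j, part i = 2 → part j = 2 → i = j

instance (r : Fin 5 → Fin 5 → Bool) (part : Fin 5 → Fin 3) : Decidable (IsPartition r part) := by
  unfold IsPartition; infer_instance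

/-- The code of the graph with code `m` after a relabelling. -/
def relabel (m : ℕ) (σ : Fin 5 → Fin 5) : ℕ :=
  code fun i j => codeBit m (label (σ i)) (label (σ j))

def transpositions : List (Fin 5 → Fin 5) :=
  [![1, 0, 2, 3, 4], ![0, 2, 1, 3, 4], ![0, 1, 3, 2, 4], ![0, 1, 2, 4, 3], ![2, 1, 0, 3, 4],
    ![0, 3, 2, 1, 4], ![0, 1, 4, 3, 2], ![3, 1, 2, 0, 4], ![0, 4, 2, 3, 1], ![4, 1, 2, 3, 0]]

/-- Partitions for the minimal codes of graphs with equality in the certificate. -/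
def tightParts : List (Fin 5 → Fin 3) :=
  [![0, 0, 0, 0, 0], ![0, 0, 0, 1, 0], ![0, 0, 1, 0, 1], ![0, 0, 1, 1, 2], ![0, 0, 2, 1, 0],
    ![0, 1, 1, 0, 1], ![0, 1, 1, 1, 2]]

/-- The first alternative spares the evaluation of `codeSum` at any code that a transposition
lowers; each isomorphism class still keeps its least code. -/
theorem codeSum_cases : ∀ m < 1024, (∃ τ ∈ transpositions, relabel m τ < m) ∨
    codeSum m < 3240 ∨ codeSum m = 3240 ∧ ∃ part ∈ tightParts,
      IsPartition (fun i j => codeBit m (label i) (label j)) part := by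
  decide +kernel

theorem code_congr {r s : Fin 5 → Fin 5 → Bool} (h : ∀ i j, i ≠ j → r i j = s i j) :
    code r = code s := by
  have hp : ∀ p : Fin 10, (bitPair p).1 ≠ (bitPair p).2 := by decide
  exact congrArg Nat.ofBits (funext fun p => h _ _ (hp p))

/-- The sum is invariant under renumbering, so the numbering with least code may be used. No
transposition lowers that code, which leaves the other two outcomes of `codeSum_cases`. -/
theorem sum_perm_certTerm_cases {r : Fin 5 → Fin 5 → Bool} (hr : ∀ i j, r i j = r j i) :
    ∑ σ : Equiv.Perm (Fin 5), certTerm r (σ 0) (σ 1) (σ 2) (σ 3) (σ 4) < 3240 ∨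
    ∑ σ : Equiv.Perm (Fin 5), certTerm r (σ 0) (σ 1) (σ 2) (σ 3) (σ 4) = 3240 ∧
      ∃ part, IsPartition r part := by
  obtain ⟨σ, hσ⟩ := Finite.exists_min fun σ : Equiv.Perm (Fin 5) => code fun i j => r (σ i) (σ j)
  set s : Fin 5 → Fin 5 → Bool := fun i j => r (σ i) (σ j) with hs
  have hsymm : ∀ i j, s i j = s j i := fun i j => hr _ _
  have hsum : ∑ π : Equiv.Perm (Fin 5), certTerm r (π 0) (π 1) (π 2) (π 3) (π 4) =
      codeSum (code s) := by
    rw [← sum_perm_certTerm_eq_codeSum hsymm, ← Equiv.sum_comp (Equiv.mulLeft σ)]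
    rfl
  rw [hsum]
  rcases codeSum_cases _ (code_lt s) with ⟨τ, hτ, hlt⟩ | h | ⟨h, part, -, hp⟩
  · have hinj : ∀ τ ∈ transpositions, Function.Injective τ := by decide +kernel
    let π : Equiv.Perm (Fin 5) := Equiv.ofBijective τ (Finite.injective_iff_bijective.1 (hinj τ hτ))
    have h1 : relabel (code s) τ = code fun i j => r ((σ * π) i) ((σ * π) j) :=
      code_congr fun i j hij => codeBit_code hsymm ((hinj τ hτ).ne hij)
    exact absurd (hσ (σ * π)) (by rw [← h1]; exact not_le.2 hlt)
  · exact .inl h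
  · refine .inr ⟨h, part ∘ σ.symm, fun i j hij => ?_, fun i j hi hj => ?_⟩
    · have h1 := hp.1 (σ.symm i) (σ.symm j) (σ.symm.injective.ne hij)
      beta_reduce at h1
      rw [codeBit_code hsymm (σ.symm.injective.ne hij)] at h1
      simpa [hs] using h1
    · exact σ.symm.injective (hp.2 _ _ hi hj)

/-! ### From Boolean relations to graphs -/

open scoped Classical in
/-- The adjacency relation of a graph with values in `Bool`. -/
noncomputable def adjBit {W : Type*} (G : SimpleGraph W) (u v : W) : Bool := decide (G.Adj u v)

theorem adjBit_comm {W : Type*} (G : SimpleGraph W) (u v : W) : adjBit G u v = adjBit G v u := by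
  simp [adjBit, G.adj_comm]

theorem adjBit_eq_true {W : Type*} (G : SimpleGraph W) (u v : W) :
    adjBit G u v = true ↔ G.Adj u v := by simp [adjBit]

theorem isCompleteBipartite_or_of_isPartition {F : SimpleGraph (Fin 5)} {part : Fin 5 → Fin 3}
    (h : IsPartition (adjBit F) part) :
    IsCompleteBipartite F ∨ IsCompleteBipartiteAddIsolated F := by
  have hadj (i j) : F.Adj i j ↔ part i ≠ part j ∧ part i ≠ 2 ∧ part j ≠ 2 := by
    by_cases hij : i = j
    · simp [hij]
    · rw [← adjBit_eq_true]; exact h.1 i j hij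
  -- The value at a vertex of part 2 is irrelevant: such a vertex is either deleted or absent.
  let side (i : Fin 5) : Fin 2 := if part i = 0 then 0 else 1
  have hside (i j) (hi : part i ≠ 2) (hj : part j ≠ 2) : part i ≠ part j ↔ side i ≠ side j := by
    have : ∀ x y : Fin 3, x ≠ 2 → y ≠ 2 →
      (x ≠ y ↔ (if x = 0 then 0 else 1 : Fin 2) ≠ if y = 0 then 0 else 1) := by decide
    exact this _ _ hi hj
  by_cases hv : ∃ v, part v = 2
  · obtain ⟨v, hv⟩ := hv
    refine .inr ⟨v, fun u => by simp [hadj, hv], fun i => side i, ?_⟩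
    ext ⟨i, hi⟩ ⟨j, hj⟩
    have hi' : part i ≠ 2 := fun h2 => hi (h.2 _ _ h2 hv)
    have hj' : part j ≠ 2 := fun h2 => hj (h.2 _ _ h2 hv)
    simp only [SimpleGraph.comap_adj, blowup, SimpleGraph.top_adj, Function.Embedding.subtype_apply,
      hadj, ← hside i j hi' hj']
    tauto
  · push Not at hv
    refine .inl ⟨side, ?_⟩
    ext i j
    simp only [SimpleGraph.comap_adj, blowup, SimpleGraph.top_adj, hadj, ← hside i j (hv i) (hv j)]
    simp [hv]

/-- The certificate inequality for a graph of order five, and its equality case. -/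
theorem sum_perm_certTerm_adjBit_cases (F : SimpleGraph (Fin 5)) :
    ∑ σ : Equiv.Perm (Fin 5), certTerm (adjBit F) (σ 0) (σ 1) (σ 2) (σ 3) (σ 4) < 3240 ∨
    ∑ σ : Equiv.Perm (Fin 5), certTerm (adjBit F) (σ 0) (σ 1) (σ 2) (σ 3) (σ 4) = 3240 ∧
      (IsCompleteBipartite F ∨ IsCompleteBipartiteAddIsolated F) :=
  (sum_perm_certTerm_cases (adjBit_comm F)).imp_right fun ⟨h, _, hp⟩ =>
    ⟨h, isCompleteBipartite_or_of_isPartition hp⟩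

/-- The indicator that `(a, b, c, d)` is an embedding of `H6`. -/
def embTerm {α : Type*} (r : α → α → Bool) (a b c d : α) : ℤ := cond (isEmb r a b c d) 1 0

/-- The indicator that `ab` is the only edge spanned by `a`, `b`, `c`. -/
def edgeInd {α : Type*} (r : α → α → Bool) (a b c : α) : ℤ := cond (edgeType r a b c) 1 0

theorem certTerm_eq {α : Type*} (r : α → α → Bool) (a b c d e : α) :
    certTerm r a b c d e = 216 * embTerm r b c d e + squareTerm r a b c d e := by
  unfold certTerm embTerm
  cases isEmb r b c d e <;> simp

theorem squareTerm_eq {α : Type*} (r : α → α → Bool) (a b c d e : α) :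
    squareTerm r a b c d e =
      3 * (rootFlag (r a b) (r a c) (r b c) * rootFlag (r a d) (r a e) (r d e)) +
      edgeInd r a b c *
        (144 * (antiFlag (r a d) (r b d) (r c d) * antiFlag (r a e) (r b e) (r c e)) +
          28 * (symFlag (r a d) (r b d) (r c d) * symFlag (r a e) (r b e) (r c e))) := by
  unfold squareTerm edgeInd
  cases edgeType r a b c <;> simp

/-! ### Counting in large graphs -/

section Counting

variable {W : Type*} [Fintype W]

theorem sum_embedding_fin_succ [DecidableEq W] (k : ℕ) (g : (Fin k → W) → ℤ) :
    ∑ f : Fin (k + 1) ↪ W, g (f ∘ Fin.succ) =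
      ((Fintype.card W : ℤ) - k) * ∑ f : Fin k ↪ W, g f := by
  rw [← Equiv.sum_comp (Equiv.embeddingFinSucc k W).symm, Fintype.sum_sigma, Finset.mul_sum]
  refine Finset.sum_congr rfl fun f _ => ?_
  have h1 : Fintype.card {i // i ∉ Set.range f} = Fintype.card W - k := by
    rw [Fintype.card_subtype_compl, ← Fintype.card_congr (Equiv.ofInjective f f.injective),
      Fintype.card_fin]
  have h2 : k ≤ Fintype.card W := by simpa using Fintype.card_le_of_embedding f
  have h3 (x : {i // i ∉ Set.range f}) :
      g (⇑((Equiv.embeddingFinSucc k W).symm ⟨f, x⟩) ∘ Fin.succ) = g f := by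
    rw [Equiv.coe_embeddingFinSucc_symm]; rfl
  simp only [h3, Finset.sum_const, Finset.card_univ, h1, nsmul_eq_mul]
  push_cast [h2]
  rfl

theorem sum_fin_succ_arrow (k : ℕ) (g : (Fin (k + 1) → W) → ℤ) :
    ∑ f : Fin (k + 1) → W, g f = ∑ a, ∑ f : Fin k → W, g (Fin.cons a f) := by
  rw [← Equiv.sum_comp (Fin.consEquiv fun _ => W), Fintype.sum_prod_type]
  rfl

theorem sum_fin_five_arrow (g : W → W → W → W → W → ℤ) :
    ∑ f : Fin 5 → W, g (f 0) (f 1) (f 2) (f 3) (f 4) =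
      ∑ a, ∑ b, ∑ c, ∑ d, ∑ e, g a b c d e := by
  simp only [sum_fin_succ_arrow, Finset.univ_unique, Finset.sum_singleton]
  rfl

theorem sum_fin_four_arrow (g : W → W → W → W → ℤ) :
    ∑ f : Fin 4 → W, g (f 0) (f 1) (f 2) (f 3) = ∑ a, ∑ b, ∑ c, ∑ d, g a b c d := by
  simp only [sum_fin_succ_arrow, Finset.univ_unique, Finset.sum_singleton]
  rfl

/-- The sum of a function bounded by `M` over injective tuples is smaller than that over all
tuples by at most `M` times the number of tuples that are not injective. -/
theorem sum_arrow_sub_sum_embedding_le [DecidableEq W] (k : ℕ) (g : (Fin k → W) → ℤ) (M : ℤ)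
    (hM : ∀ f, g f ≤ M) :
    ∑ f, g f - ∑ f : Fin k ↪ W, g f ≤
      M * ((Fintype.card W : ℤ) ^ k - (Fintype.card W).descFactorial k) := by
  have h1 (h : (Fin k → W) → ℤ) : ∑ f : Fin k ↪ W, h f =
      ∑ f ∈ Finset.univ.filter Function.Injective, h f := by
    rw [← Equiv.sum_comp (Equiv.subtypeInjectiveEquivEmbedding (Fin k) W)]
    exact (Finset.sum_subtype _ (by simp) _).symm
  have h2 : ∑ f : Fin k → W, (M - g f) - ∑ f : Fin k ↪ W, (M - g f) ≥ 0 := by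
    rw [h1 fun f => M - g f]
    exact sub_nonneg.2 (Finset.sum_le_sum_of_subset_of_nonneg (Finset.subset_univ _)
      fun f _ _ => sub_nonneg.2 (hM f))
  simp only [Finset.sum_sub_distrib, Finset.sum_const, Finset.card_univ, Fintype.card_embedding_eq,
    Fintype.card_fun, Fintype.card_fin, nsmul_eq_mul, Nat.cast_pow] at h2
  linarith

/-- With repetitions allowed, the sums over `(b, c)` and `(d, e)`, or over `d` and `e`, are
independent, so each product factors into a square. -/
theorem sum_squareTerm_nonneg (r : W → W → Bool) :
    0 ≤ ∑ a, ∑ b, ∑ c, ∑ d, ∑ e, squareTerm r a b c d e := by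
  have h1 (a : W) : ∑ b, ∑ c, ∑ d, ∑ e, 3 * (rootFlag (r a b) (r a c) (r b c) *
      rootFlag (r a d) (r a e) (r d e)) = 3 * (∑ b, ∑ c, rootFlag (r a b) (r a c) (r b c)) ^ 2 := by
    simp only [← Finset.mul_sum, ← Finset.sum_mul, sq]
  have h2 (a b c : W) : ∑ d, ∑ e, edgeInd r a b c *
      (144 * (antiFlag (r a d) (r b d) (r c d) * antiFlag (r a e) (r b e) (r c e)) +
      28 * (symFlag (r a d) (r b d) (r c d) * symFlag (r a e) (r b e) (r c e))) =
      edgeInd r a b c * (144 * (∑ d, antiFlag (r a d) (r b d) (r c d)) ^ 2 +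
        28 * (∑ d, symFlag (r a d) (r b d) (r c d)) ^ 2) := by
    simp only [← Finset.mul_sum, ← Finset.sum_mul, Finset.sum_add_distrib, sq]
  have h3 (a b c : W) : 0 ≤ edgeInd r a b c := by
    unfold edgeInd; cases edgeType r a b c <;> simp
  simp only [squareTerm_eq, Finset.sum_add_distrib, h1, h2]
  refine add_nonneg (Finset.sum_nonneg fun a _ => by positivity) (Finset.sum_nonneg fun a _ =>
    Finset.sum_nonneg fun b _ => Finset.sum_nonneg fun c _ => mul_nonneg (h3 a b c) (by positivity))

theorem sum_embedding_squareTerm_ge [DecidableEq W] (r : W → W → Bool) :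
    -(283 * ((Fintype.card W : ℤ) ^ 5 - (Fintype.card W).descFactorial 5)) ≤
      ∑ f : Fin 5 ↪ W, squareTerm r (f 0) (f 1) (f 2) (f 3) (f 4) := by
  have h1 := sum_arrow_sub_sum_embedding_le (W := W) 5
    (fun f => squareTerm r (f 0) (f 1) (f 2) (f 3) (f 4)) 283 fun f => squareTerm_le ..
  rw [sum_fin_five_arrow] at h1
  linarith [sum_squareTerm_nonneg r]

end Counting

/-! ### Upper bound for the embedding density of `H6` -/

section Counting

variable {W : Type*} [Fintype W]

theorem isEmbedding_H6_iff {W : Type*} {G : SimpleGraph W} {f : Fin 4 ↪ W} :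
    IsEmbedding H6 G f ↔ G.Adj (f 0) (f 2) ∧ ¬ G.Adj (f 0) (f 1) ∧ ¬ G.Adj (f 0) (f 3) ∧
      ¬ G.Adj (f 1) (f 3) := by
  constructor
  · rintro ⟨hr, hb⟩
    exact ⟨hr 0 2 (by simp [H6]), hb 0 1 (by simp [H6]), hb 0 3 (by simp [H6]),
      hb 1 3 (by simp [H6])⟩
  · rintro ⟨h02, h01, h03, h13⟩
    refine ⟨fun u v h => ?_, fun u v h => ?_⟩
    · simp only [H6, SimpleGraph.fromEdgeSet_adj, Set.mem_singleton_iff, Sym2.eq_iff] at h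
      rcases h.1 with ⟨rfl, rfl⟩ | ⟨rfl, rfl⟩
      exacts [h02, h02.symm]
    · simp only [H6, SimpleGraph.fromEdgeSet_adj, Set.mem_insert_iff, Set.mem_singleton_iff,
        Sym2.eq_iff] at h
      rcases h.1 with (⟨rfl, rfl⟩ | ⟨rfl, rfl⟩) | (⟨rfl, rfl⟩ | ⟨rfl, rfl⟩) |
        (⟨rfl, rfl⟩ | ⟨rfl, rfl⟩)
      exacts [h01, fun h => h01 h.symm, h03, fun h => h03 h.symm, h13, fun h => h13 h.symm]

theorem embCount_H6_eq_sum [DecidableEq W] (G : SimpleGraph W) :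
    (embCount H6 G : ℤ) =
      ∑ f : Fin 4 ↪ W, embTerm (adjBit G) (f 0) (f 1) (f 2) (f 3) := by
  classical
  have h (f : Fin 4 ↪ W) : embTerm (adjBit G) (f 0) (f 1) (f 2) (f 3) =
      if IsEmbedding H6 G f then 1 else 0 := by
    simp [embTerm, isEmb, isEmbedding_H6_iff, adjBit, Bool.cond_eq_ite, and_assoc]
  simp only [h, Finset.sum_boole, embCount]

/-- The vertex `f 0` is free: each embedding extends by any of the `n - 4` remaining vertices. -/
theorem card_sub_four_mul_embCount [DecidableEq W] (G : SimpleGraph W) :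
    ((Fintype.card W : ℤ) - 4) * embCount H6 G =
      ∑ f : Fin 5 ↪ W, embTerm (adjBit G) (f 1) (f 2) (f 3) (f 4) := by
  rw [embCount_H6_eq_sum]
  exact_mod_cast (sum_embedding_fin_succ 4
    fun f : Fin 4 → W => embTerm (adjBit G) (f 0) (f 1) (f 2) (f 3)).symm

/-- The graphs whose slack in the certificate is allowed to vanish. -/
def IsTight {V : Type*} (F : SimpleGraph V) : Prop :=
  IsCompleteBipartite F ∨ IsCompleteBipartiteAddIsolated F

open scoped Classical in
/-- The number of injections of five vertices into `G` spanning a graph that is not tight. -/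
noncomputable def looseCount (G : SimpleGraph W) : ℕ :=
  (Finset.univ.filter fun f : Fin 5 ↪ W => ¬ IsTight (G.comap f)).card

/-- Reordering the entries permutes the injective quintuples, so 120 times the sum regroups into the
sums bounded by the five-vertex inequality. -/
theorem sum_certTerm_le [DecidableEq W] (G : SimpleGraph W) :
    120 * ∑ f : Fin 5 ↪ W, certTerm (adjBit G) (f 0) (f 1) (f 2) (f 3) (f 4) ≤
      3240 * (Fintype.card W).descFactorial 5 - looseCount G := by
  classical
  have h1 (σ : Equiv.Perm (Fin 5)) :
      ∑ f : Fin 5 ↪ W, certTerm (adjBit G) (f (σ 0)) (f (σ 1)) (f (σ 2)) (f (σ 3)) (f (σ 4)) =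
        ∑ f : Fin 5 ↪ W, certTerm (adjBit G) (f 0) (f 1) (f 2) (f 3) (f 4) := by
    rw [← Equiv.sum_comp (σ.embeddingCongr (Equiv.refl W))]
    simp [Function.Embedding.congr]
  have h2 : ∑ f : Fin 5 ↪ W, ∑ σ : Equiv.Perm (Fin 5),
      certTerm (adjBit G) (f (σ 0)) (f (σ 1)) (f (σ 2)) (f (σ 3)) (f (σ 4)) =
      120 * ∑ f : Fin 5 ↪ W, certTerm (adjBit G) (f 0) (f 1) (f 2) (f 3) (f 4) := by
    rw [Finset.sum_comm]
    simp [h1, Fintype.card_perm, Nat.factorial]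
  have h3 (f : Fin 5 ↪ W) : ∑ σ : Equiv.Perm (Fin 5),
      certTerm (adjBit G) (f (σ 0)) (f (σ 1)) (f (σ 2)) (f (σ 3)) (f (σ 4)) ≤
      3240 - if ¬ IsTight (G.comap f) then 1 else 0 := by
    rcases sum_perm_certTerm_adjBit_cases (G.comap f) with h | ⟨h, h'⟩
    · have h4 := Int.le_sub_one_of_lt h
      split_ifs
      · exact h4.trans (by norm_num)
      · exact h4
    · rw [if_neg (not_not.2 (show IsTight _ from h'))]
      exact h.le
  rw [← h2]
  refine (Finset.sum_le_sum fun f _ => h3 f).trans_eq ?_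
  rw [Finset.sum_sub_distrib, Finset.sum_boole, looseCount, Finset.sum_const, Finset.card_univ,
    Fintype.card_embedding_eq, Fintype.card_fin, nsmul_eq_mul, mul_comm]

theorem embCount_H6_le (G : SimpleGraph W) :
    120 * (216 * (((Fintype.card W : ℤ) - 4) * embCount H6 G) -
      283 * ((Fintype.card W : ℤ) ^ 5 - (Fintype.card W).descFactorial 5)) ≤
      3240 * (Fintype.card W).descFactorial 5 - looseCount G := by
  classical
  have h1 := sum_certTerm_le G
  simp only [certTerm_eq, Finset.sum_add_distrib, ← Finset.mul_sum] at h1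
  rw [← card_sub_four_mul_embCount] at h1
  linarith [sum_embedding_squareTerm_ge (adjBit G)]

theorem embDensity_H6_le (G : SimpleGraph W) (hW : 5 ≤ Fintype.card W) :
    embDensity H6 G ≤ 1 / 8 +
      283 / 216 * ((Fintype.card W : ℝ) ^ 5 / (Fintype.card W).descFactorial 5 - 1) -
      looseCount G / (Fintype.card W).descFactorial 5 / 25920 := by
  have h1 : (120 * (216 * (((Fintype.card W : ℝ) - 4) * embCount H6 G) -
      283 * ((Fintype.card W : ℝ) ^ 5 - (Fintype.card W).descFactorial 5)) : ℝ) ≤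
      3240 * (Fintype.card W).descFactorial 5 - looseCount G := by exact_mod_cast embCount_H6_le G
  have h4 : (0 : ℝ) < (Fintype.card W).descFactorial 4 := by
    exact_mod_cast Nat.descFactorial_pos.2 (by omega)
  have h5 : ((Fintype.card W).descFactorial 5 : ℝ) =
      ((Fintype.card W : ℝ) - 4) * (Fintype.card W).descFactorial 4 := by
    rw [Nat.descFactorial_succ]; push_cast [show 4 ≤ Fintype.card W by omega]; ring
  have hpos : (0 : ℝ) < (Fintype.card W : ℝ) - 4 := by
    have : (5 : ℝ) ≤ Fintype.card W := by exact_mod_cast hW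
    linarith
  -- It remains to divide by 25920 = 120 * 216, which turns 3240 into 1/8 and 120 * 283 into
  -- 283/216.
  rw [embDensity, Fintype.card_fin]
  have h6 : (embCount H6 G : ℝ) / (Fintype.card W).descFactorial 4 =
      ((Fintype.card W : ℝ) - 4) * embCount H6 G / (Fintype.card W).descFactorial 5 := by
    rw [h5, mul_div_mul_left _ _ hpos.ne']
  rw [h6]
  have hd : (0 : ℝ) < (Fintype.card W).descFactorial 5 := by rw [h5]; positivity
  rw [div_le_iff₀ hd]
  field_simp
  linarith

/-- The induced density of a graph that is not tight bounds the loose quintuples from below. -/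
theorem inducedDensity_le (F : SimpleGraph (Fin 5)) (hF : ¬ IsTight F) (G : SimpleGraph W) :
    inducedDensity F G ≤ 120 * (looseCount G / (Fintype.card W).descFactorial 5) := by
  classical
  have hcard (S : Finset (Set W)) :
      (S.filter fun X => Nonempty (G.induce X ≃g F)).card ≤ looseCount G := by
    -- One loose injection per set is enough here, at the price of the factor 120.
    have hsub : (S.filter fun X => Nonempty (G.induce X ≃g F)) ⊆
        (Finset.univ.filter fun f : Fin 5 ↪ W => ¬ IsTight (G.comap f)).image
          fun f : Fin 5 ↪ W => Set.range f := by
      intro X hX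
      obtain ⟨-, ⟨φ⟩⟩ := Finset.mem_filter.1 hX
      let f : F ↪g G := φ.symm.toEmbedding.trans (SimpleGraph.Embedding.induce X)
      refine Finset.mem_image.2 ⟨f.toEmbedding, Finset.mem_filter.2 ⟨Finset.mem_univ _, ?_⟩, ?_⟩
      · convert hF
        exact SimpleGraph.Embedding.comap_eq f
      · ext x
        constructor
        · rintro ⟨i, rfl⟩
          exact (φ.symm i).2
        · intro hx
          exact ⟨φ ⟨x, hx⟩, congrArg Subtype.val (φ.symm_apply_apply ⟨x, hx⟩)⟩
    exact (Finset.card_le_card hsub).trans Finset.card_image_le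
  have h2 : ((Fintype.card W).choose 5 : ℝ) = (Fintype.card W).descFactorial 5 / 120 := by
    rw [Nat.descFactorial_eq_factorial_mul_choose]; push_cast [Nat.factorial]; ring
  rw [inducedDensity, Fintype.card_fin, h2, div_div_eq_mul_div, mul_comm _ (120 : ℝ), mul_div_assoc]
  gcongr
  convert hcard _

end Counting

/-! ### The certificate -/

/-- Two flags that cover all `N` vertices and share exactly their first `k` vertices identify the
pairs of flags with the bijections of the `N` vertices. -/
theorem sum_flagPairs {N k l : ℕ} (p q : Fin (k + l) ↪ Fin N)
    (hpq : ∀ i j, p i = q j ↔ i = j ∧ (i : ℕ) < k) (hcov : ∀ x, (∃ i, p i = x) ∨ ∃ i, q i = x)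
    (g : (Fin (k + l) ↪ Fin N) × (Fin (k + l) ↪ Fin N) → ℝ) :
    ∑ e ∈ flagPairs N k l, g e = ∑ f : Fin N ↪ Fin N, g (p.trans f, q.trans f) := by
  classical
  symm
  refine Finset.sum_bij (fun f _ => (p.trans f, q.trans f)) (fun f _ => ?_) (fun f _ f' _ h => ?_)
    (fun e he => ?_) fun _ _ => rfl
  · simp [flagPairs, hpq]
  · ext x
    simp only [Prod.mk.injEq] at h
    rcases hcov x with ⟨i, rfl⟩ | ⟨i, rfl⟩
    · exact congrArg Fin.val (DFunLike.congr_fun h.1 i)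
    · exact congrArg Fin.val (DFunLike.congr_fun h.2 i)
  · have he' : ∀ i j, e.1 i = e.2 j ↔ i = j ∧ (i : ℕ) < k := (Finset.mem_filter.1 he).2
    -- The last default is never reached, since `p` and `q` cover all vertices.
    let f (x : Fin N) : Fin N :=
      if h : ∃ i, p i = x then e.1 h.choose else if h : ∃ i, q i = x then e.2 h.choose else x
    have hp (i) : f (p i) = e.1 i := by
      have h : ∃ j, p j = p i := ⟨i, rfl⟩
      simp only [f, dif_pos h]
      rw [p.injective h.choose_spec]
    have hq (j) : f (q j) = e.2 j := by
      by_cases h : ∃ i, p i = q j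
      · obtain ⟨i, hi⟩ := h
        rw [← hi, hp, he', ← hpq, hi]
      · have h' : ∃ i, q i = q j := ⟨j, rfl⟩
        simp only [f, dif_neg h, dif_pos h']
        rw [q.injective h'.choose_spec]
    have hf : Function.Injective f := by
      intro x y hxy
      rcases hcov x with ⟨i, rfl⟩ | ⟨i, rfl⟩ <;> rcases hcov y with ⟨j, rfl⟩ | ⟨j, rfl⟩ <;>
        simp only [hp, hq] at hxy
      · rw [e.1.injective hxy]
      · exact (hpq _ _).2 ((he' _ _).1 hxy)
      · exact ((hpq _ _).2 ((he' _ _).1 hxy.symm)).symm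
      · rw [e.2.injective hxy]
    exact ⟨⟨f, hf⟩, Finset.mem_univ _, Prod.ext (by ext; simp [hp]) (by ext; simp [hq])⟩

/-- One model pair `p`, `q` turns the expectation over flag pairs into an average over all orderings
of the `N` vertices, the form in which `certTerm` is summed. -/
theorem sosCoeff_eq_sum {N k l : ℕ} (p q : Fin (k + l) ↪ Fin N)
    (hpq : ∀ i j, p i = q j ↔ i = j ∧ (i : ℕ) < k) (hcov : ∀ x, (∃ i, p i = x) ∨ ∃ i, q i = x)
    (Q : Matrix (SimpleGraph (Fin (k + l))) (SimpleGraph (Fin (k + l))) ℝ)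
    (F : SimpleGraph (Fin N)) :
    sosCoeff k l Q F = (∑ f : Fin N ↪ Fin N, Q (F.comap (f ∘ p)) (F.comap (f ∘ q))) /
      (N.factorial : ℝ) := by
  have hcard : ((flagPairs N k l).card : ℝ) = N.factorial := by
    rw [Finset.card_eq_sum_ones, Nat.cast_sum, sum_flagPairs p q hpq hcov, Finset.sum_const,
      Finset.card_univ, Fintype.card_embedding_eq]
    simp [Nat.descFactorial_self]
  rw [sosCoeff, hcard, sum_flagPairs p q hpq hcov fun e => Q (F.comap e.1) (F.comap e.2)]
  rfl

/-- The vector of the square over one root. -/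
noncomputable def rootVec (F : SimpleGraph (Fin 3)) : ℝ :=
  rootFlag (adjBit F 0 1) (adjBit F 0 2) (adjBit F 1 2)

/-- The vector of the antisymmetric square over three roots. -/
noncomputable def antiVec (F : SimpleGraph (Fin 4)) : ℝ :=
  edgeInd (adjBit F) 0 1 2 * antiFlag (adjBit F 0 3) (adjBit F 1 3) (adjBit F 2 3)

/-- The vector of the symmetric square over three roots. -/
noncomputable def symVec (F : SimpleGraph (Fin 4)) : ℝ :=
  edgeInd (adjBit F) 0 1 2 * symFlag (adjBit F 0 3) (adjBit F 1 3) (adjBit F 2 3)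

/-- The matrices of the certificate. -/
noncomputable def certMatrix :
    (k l : ℕ) → Matrix (SimpleGraph (Fin (k + l))) (SimpleGraph (Fin (k + l))) ℝ
  -- The coefficients are 3, 144 and 28 divided by 216.
  | 1, 2 => (1 / 72 : ℝ) • Matrix.vecMulVec rootVec rootVec
  | 3, 1 => (2 / 3 : ℝ) • Matrix.vecMulVec antiVec antiVec +
      (7 / 54 : ℝ) • Matrix.vecMulVec symVec symVec
  | _, _ => 0

theorem certMatrix_eq_zero {k l : ℕ} (h1 : (k, l) ≠ (1, 2)) (h2 : (k, l) ≠ (3, 1)) :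
    certMatrix k l = 0 := by
  unfold certMatrix
  split
  · exact absurd rfl h1
  · exact absurd rfl h2
  · rfl

theorem posSemidef_smul_vecMulVec {n : Type*} [Finite n] (c : ℝ) (hc : 0 ≤ c) (v : n → ℝ) :
    (c • Matrix.vecMulVec v v).PosSemidef :=
  (by simpa using Matrix.posSemidef_vecMulVec_self_star v :
    (Matrix.vecMulVec v v).PosSemidef).smul hc

theorem posSemidef_certMatrix (k l : ℕ) : (certMatrix k l).PosSemidef := by
  by_cases h1 : (k, l) = (1, 2)
  · obtain ⟨rfl, rfl⟩ := Prod.mk.inj h1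
    exact posSemidef_smul_vecMulVec _ (by norm_num) rootVec
  by_cases h2 : (k, l) = (3, 1)
  · obtain ⟨rfl, rfl⟩ := Prod.mk.inj h2
    exact (posSemidef_smul_vecMulVec _ (by norm_num) antiVec).add
      (posSemidef_smul_vecMulVec _ (by norm_num) symVec)
  · rw [certMatrix_eq_zero h1 h2]
    exact .zero

theorem sum_sosCoeff_certMatrix (F : SimpleGraph (Fin 5)) :
    ∑ kl ∈ (Finset.range (5 + 1) ×ˢ Finset.range (5 + 1)).filter
    (fun kl : ℕ × ℕ => kl.1 + 2 * kl.2 ≤ 5), sosCoeff kl.1 kl.2 (certMatrix kl.1 kl.2) F =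
    sosCoeff 1 2 (certMatrix 1 2) F + sosCoeff 3 1 (certMatrix 3 1) F := by
  refine Finset.sum_eq_add (1, 2) (3, 1) (by decide) (fun kl _ h => ?_) (fun h => ?_)
    fun h => ?_
  · rw [certMatrix_eq_zero h.1 h.2]
    simp [sosCoeff]
  · exact absurd (by decide) h
  · exact absurd (by decide) h

theorem certTerm_eq_certMatrix (F : SimpleGraph (Fin 5)) (f : Fin 5 ↪ Fin 5) :
    (certTerm (adjBit F) (f 0) (f 1) (f 2) (f 3) (f 4) : ℝ) =
    216 * embTerm (adjBit F) (f 1) (f 2) (f 3) (f 4) +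
    216 * certMatrix 1 2 (F.comap (f ∘ (![0, 1, 2] : Fin 3 → Fin 5)))
      (F.comap (f ∘ (![0, 3, 4] : Fin 3 → Fin 5))) +
    216 * certMatrix 3 1 (F.comap (f ∘ (![0, 1, 2, 3] : Fin 4 → Fin 5)))
      (F.comap (f ∘ (![0, 1, 2, 4] : Fin 4 → Fin 5))) := by
  -- The edge indicator enters `squareTerm` once but the product of two flag vectors twice, so its
  -- idempotence is needed.
  have he (c : ℝ) (hc : c = edgeInd (adjBit F) (f 0) (f 1) (f 2)) : c * c = c := by
    rw [hc, edgeInd]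
    cases edgeType (adjBit F) (f 0) (f 1) (f 2) <;> simp
  have h1 : certMatrix 1 2 (F.comap (f ∘ (![0, 1, 2] : Fin 3 → Fin 5)))
      (F.comap (f ∘ (![0, 3, 4] : Fin 3 → Fin 5))) = (1 / 72) *
      (rootFlag (adjBit F (f 0) (f 1)) (adjBit F (f 0) (f 2)) (adjBit F (f 1) (f 2)) *
      rootFlag (adjBit F (f 0) (f 3)) (adjBit F (f 0) (f 4)) (adjBit F (f 3) (f 4))) := rfl
  have h2 : certMatrix 3 1 (F.comap (f ∘ (![0, 1, 2, 3] : Fin 4 → Fin 5)))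
      (F.comap (f ∘ (![0, 1, 2, 4] : Fin 4 → Fin 5))) =
      (2 / 3) * ((edgeInd (adjBit F) (f 0) (f 1) (f 2) *
        antiFlag (adjBit F (f 0) (f 3)) (adjBit F (f 1) (f 3)) (adjBit F (f 2) (f 3))) *
        (edgeInd (adjBit F) (f 0) (f 1) (f 2) *
        antiFlag (adjBit F (f 0) (f 4)) (adjBit F (f 1) (f 4)) (adjBit F (f 2) (f 4)))) +
      (7 / 54) * ((edgeInd (adjBit F) (f 0) (f 1) (f 2) *
        symFlag (adjBit F (f 0) (f 3)) (adjBit F (f 1) (f 3)) (adjBit F (f 2) (f 3))) *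
        (edgeInd (adjBit F) (f 0) (f 1) (f 2) *
        symFlag (adjBit F (f 0) (f 4)) (adjBit F (f 1) (f 4)) (adjBit F (f 2) (f 4)))) := rfl
  rw [h1, h2, certTerm_eq, squareTerm_eq]
  push_cast
  generalize hc : (edgeInd (adjBit F) (f 0) (f 1) (f 2) : ℝ) = c
  have := he c hc.symm
  linear_combination (-(144 : ℝ) * antiFlag (adjBit F (f 0) (f 3)) (adjBit F (f 1) (f 3))
    (adjBit F (f 2) (f 3)) * antiFlag (adjBit F (f 0) (f 4)) (adjBit F (f 1) (f 4))
    (adjBit F (f 2) (f 4)) - 28 * symFlag (adjBit F (f 0) (f 3)) (adjBit F (f 1) (f 3))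
    (adjBit F (f 2) (f 3)) * symFlag (adjBit F (f 0) (f 4)) (adjBit F (f 1) (f 4))
    (adjBit F (f 2) (f 4))) * this

/-- The slacks of the certificate. -/
noncomputable def certSlack (F : SimpleGraph (Fin 5)) : ℝ :=
  (3240 - ∑ f : Fin 5 ↪ Fin 5, (certTerm (adjBit F) (f 0) (f 1) (f 2) (f 3) (f 4) : ℝ)) / 25920

theorem certSlack_nonneg (F : SimpleGraph (Fin 5)) : 0 ≤ certSlack F := by
  have h := (Int.cast_le (R := ℝ)).2 (sum_certTerm_le F)
  rw [show (Fintype.card (Fin 5)).descFactorial 5 = 120 by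
    rw [Fintype.card_fin, Nat.descFactorial_self]; rfl] at h
  push_cast at h
  have h4 : (0 : ℝ) ≤ looseCount F := by positivity
  rw [certSlack]
  refine div_nonneg ?_ (by norm_num)
  linarith

theorem embDensity_H6_fin_five (F : SimpleGraph (Fin 5)) : embDensity H6 F =
    (∑ f : Fin 5 ↪ Fin 5, (embTerm (adjBit F) (f 1) (f 2) (f 3) (f 4) : ℝ)) / 120 := by
  have h : (((Fintype.card (Fin 5) : ℝ) - 4) * embCount H6 F : ℝ) =
      ∑ f : Fin 5 ↪ Fin 5, (embTerm (adjBit F) (f 1) (f 2) (f 3) (f 4) : ℝ) := by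
    exact_mod_cast card_sub_four_mul_embCount F
  rw [← h, embDensity, Fintype.card_fin, Fintype.card_fin]
  norm_num [Nat.descFactorial]

theorem sub_embDensity_H6_fin_five (F : SimpleGraph (Fin 5)) :
    1 / 8 - embDensity H6 F =
      sosCoeff 1 2 (certMatrix 1 2) F + sosCoeff 3 1 (certMatrix 3 1) F + certSlack F := by
  have h12 := sosCoeff_eq_sum (k := 1) (l := 2) (⟨![0, 1, 2], by decide⟩ : Fin 3 ↪ Fin 5)
    ⟨![0, 3, 4], by decide⟩ (by decide) (by decide) (certMatrix 1 2) F
  have h31 := sosCoeff_eq_sum (k := 3) (l := 1) (⟨![0, 1, 2, 3], by decide⟩ : Fin 4 ↪ Fin 5)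
    ⟨![0, 1, 2, 4], by decide⟩ (by decide) (by decide) (certMatrix 3 1) F
  have hfac : (Nat.factorial 5 : ℝ) = 120 := by norm_num [Nat.factorial]
  rw [h12, h31, embDensity_H6_fin_five, hfac, certSlack]
  simp only [certTerm_eq_certMatrix, Finset.sum_add_distrib, ← Finset.mul_sum,
    Function.Embedding.coeFn_mk]
  ring

theorem hasFlagCertificate_H6 : HasFlagCertificate H6 5 (1 / 8) := by
  refine ⟨by simp, certSlack, certMatrix, certSlack_nonneg, posSemidef_certMatrix, fun F => ?_⟩
  rw [sum_sosCoeff_certMatrix, sub_embDensity_H6_fin_five]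

/-! ### Asymptotics -/

theorem tendsto_pow_div_descFactorial (k : ℕ) :
    Tendsto (fun n : ℕ => (n : ℝ) ^ k / n.descFactorial k) atTop (𝓝 1) := by
  refine (Asymptotics.isEquivalent_iff_tendsto_one ?_).1 (isEquivalent_descFactorial k).symm
  filter_upwards [eventually_ge_atTop k] with n hn
  exact_mod_cast (Nat.descFactorial_pos.2 hn).ne'

/-- The error term in the upper bound for graphs of order `n`. -/
noncomputable def upperError (n : ℕ) : ℝ := 283 / 216 * ((n : ℝ) ^ 5 / n.descFactorial 5 - 1)

theorem tendsto_upperError : Tendsto upperError atTop (𝓝 0) := by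
  have h := ((tendsto_pow_div_descFactorial 5).sub_const 1).const_mul (283 / 216)
  rwa [sub_self, mul_zero] at h

theorem embDensity_H6_le_add_upperError {W : Type*} [Fintype W] (G : SimpleGraph W)
    (hW : 5 ≤ Fintype.card W) : embDensity H6 G ≤ 1 / 8 + upperError (Fintype.card W) := by
  have h : 0 ≤ (looseCount G : ℝ) / (Fintype.card W).descFactorial 5 / 25920 := by positivity
  have := embDensity_H6_le G hW
  rw [upperError]
  linarith

theorem sum_embTerm_blowup {W : Type*} [Fintype W] (part : W → Fin 2) :
    ∑ a, ∑ b, ∑ c, ∑ d, embTerm (adjBit (blowup (⊤ : SimpleGraph (Fin 2)) part)) a b c d =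
      ∑ j : Fin 2, ((Finset.univ.filter fun v => part v = j).card : ℤ) ^ 3 *
        (Finset.univ.filter fun v => part v = 1 - j).card := by
  classical
  have h1 (a b c d : W) : embTerm (adjBit (blowup (⊤ : SimpleGraph (Fin 2)) part)) a b c d =
      (if part b = part a then 1 else 0) * ((if part c = 1 - part a then 1 else 0) *
        (if part d = part a then 1 else 0)) := by
    have h : ∀ i j k l : Fin 2, (cond (decide (i ≠ k) && !decide (i ≠ j) && !decide (i ≠ l) &&
        !decide (j ≠ l)) 1 0 : ℤ) = (if j = i then 1 else 0) * ((if k = 1 - i then 1 else 0) *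
        (if l = i then 1 else 0)) := by decide
    rw [← h]
    simp [embTerm, isEmb, adjBit, blowup]
  have h2 (a : W) : ∑ b, ∑ c, ∑ d,
      embTerm (adjBit (blowup (⊤ : SimpleGraph (Fin 2)) part)) a b c d =
      ((Finset.univ.filter fun v => part v = part a).card : ℤ) ^ 2 *
        (Finset.univ.filter fun v => part v = 1 - part a).card := by
    simp only [h1, ← Finset.mul_sum, ← Finset.sum_mul, Finset.sum_boole]
    ring
  simp only [h2]
  rw [← Finset.sum_fiberwise (s := Finset.univ) (g := part)]
  refine Finset.sum_congr rfl fun j _ => ?_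
  rw [Finset.sum_congr rfl fun a ha => by rw [(Finset.mem_filter.1 ha).2], Finset.sum_const,
    nsmul_eq_mul]
  ring

/-- Counting all quadruples overshoots the embeddings by at most the number of non-injective
quadruples, a fraction that tends to 0. -/
theorem embDensity_H6_blowup_ge {W : Type*} [Fintype W] (hW : 4 ≤ Fintype.card W)
    (part : W → Fin 2) :
    (∑ j : Fin 2, (((Finset.univ.filter fun v => part v = j).card : ℝ) / Fintype.card W) ^ 3 *
        (((Finset.univ.filter fun v => part v = 1 - j).card : ℝ) / Fintype.card W)) *
      ((Fintype.card W : ℝ) ^ 4 / (Fintype.card W).descFactorial 4) -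
      ((Fintype.card W : ℝ) ^ 4 / (Fintype.card W).descFactorial 4 - 1) ≤
    embDensity H6 (blowup (⊤ : SimpleGraph (Fin 2)) part) := by
  classical
  set G := blowup (⊤ : SimpleGraph (Fin 2)) part with hG
  have h1 := sum_arrow_sub_sum_embedding_le (W := W) 4
    (fun f => embTerm (adjBit G) (f 0) (f 1) (f 2) (f 3)) 1 fun f => by
      unfold embTerm; cases isEmb (adjBit G) (f 0) (f 1) (f 2) (f 3) <;> simp
  rw [sum_fin_four_arrow, ← embCount_H6_eq_sum, hG, sum_embTerm_blowup, ← hG] at h1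
  have h2 : (∑ j : Fin 2, ((Finset.univ.filter fun v => part v = j).card : ℝ) ^ 3 *
      (Finset.univ.filter fun v => part v = 1 - j).card) - embCount H6 G ≤
      (Fintype.card W : ℝ) ^ 4 - (Fintype.card W).descFactorial 4 := by
    rw [one_mul] at h1
    exact_mod_cast h1
  have hd : (0 : ℝ) < (Fintype.card W).descFactorial 4 := by
    exact_mod_cast Nat.descFactorial_pos.2 hW
  have hc : (0 : ℝ) < Fintype.card W := by exact_mod_cast (by omega : 0 < Fintype.card W)
  rw [embDensity, Fintype.card_fin, le_div_iff₀ hd]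
  simp only [Fin.sum_univ_two] at h2 ⊢
  field_simp
  linarith

theorem tendsto_embDensity_H6_blowup (part : (n : ℕ) → Fin n → Fin 2)
    (hpart : ∀ j : Fin 2, Tendsto
      (fun n : ℕ => ((Finset.univ.filter (fun v : Fin n => part n v = j)).card : ℝ) / (n : ℝ))
      atTop (𝓝 (1 / 2))) :
    Tendsto (fun n : ℕ => embDensity H6 (blowup (⊤ : SimpleGraph (Fin 2)) (part n))) atTop
      (𝓝 (1 / 8)) := by
  have hlow := ((tendsto_finsetSum Finset.univ fun (j : Fin 2) _ =>
    ((hpart j).pow 3).mul (hpart (1 - j))).mul (tendsto_pow_div_descFactorial 4)).sub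
    ((tendsto_pow_div_descFactorial 4).sub_const 1)
  have hup := tendsto_upperError.const_add (1 / 8)
  refine tendsto_of_tendsto_of_tendsto_of_le_of_le' (by convert hlow using 2; norm_num)
    (by simpa using hup) ?_ ?_
  · filter_upwards [eventually_ge_atTop 4] with n hn
    simpa using embDensity_H6_blowup_ge (by simpa using hn) (part n)
  · filter_upwards [eventually_ge_atTop 5] with n hn
    simpa using embDensity_H6_le_add_upperError
      (blowup (⊤ : SimpleGraph (Fin 2)) (part n)) (by simpa using hn)

/-- A partition of `n` vertices into two parts whose sizes differ by at most one. -/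
def halves (n : ℕ) (v : Fin n) : Fin 2 := if (v : ℕ) < n / 2 then 0 else 1

theorem tendsto_card_halves (j : Fin 2) : Tendsto
    (fun n : ℕ => ((Finset.univ.filter (fun v : Fin n => halves n v = j)).card : ℝ) / (n : ℝ))
    atTop (𝓝 (1 / 2)) := by
  have h0 (n : ℕ) : (Finset.univ.filter (fun v : Fin n => halves n v = 0)).card = n / 2 := by
    simp [halves, Fin.card_filter_val_lt, Nat.div_le_self]
  have hlim : Tendsto (fun n : ℕ => ((n / 2 : ℕ) : ℝ) / n) atTop (𝓝 (1 / 2)) := by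
    have h := (tendsto_nat_floor_mul_div_atTop (R := ℝ) (a := 1 / 2) (by norm_num)).comp
      tendsto_natCast_atTop_atTop
    refine h.congr fun n => ?_
    simp only [Function.comp_apply]
    rw [one_div_mul_eq_div, Nat.floor_div_ofNat, Nat.floor_natCast]
  fin_cases j
  · simpa [h0] using hlim
  · have h1 (n : ℕ) : ((Finset.univ.filter (fun v : Fin n => halves n v = 1)).card : ℝ) =
        n - (n / 2 : ℕ) := by
      have h := Finset.card_filter_add_card_filter_not (s := Finset.univ)
        (fun v : Fin n => halves n v = 0)
      have h2 : ∀ x : Fin 2, ¬ x = 0 ↔ x = 1 := by decide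
      simp only [h2, h0, Finset.card_univ, Fintype.card_fin] at h
      rw [eq_sub_iff_add_eq']
      exact_mod_cast h
    have h2 := hlim.const_sub 1
    refine (Tendsto.congr' ?_ h2).trans (by norm_num)
    filter_upwards [eventually_gt_atTop 0] with n hn
    simp only [Fin.mk_one, h1]
    have : (n : ℝ) ≠ 0 := by positivity
    field_simp

/-- The maximum lies between the density of the bipartite graph on `halves` and the upper bound
applied to a maximiser. -/
theorem hasSemiInducibilityConstant_H6 : HasSemiInducibilityConstant H6 (1 / 8) := by
  classical
  refine tendsto_of_tendsto_of_tendsto_of_le_of_le'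
    (tendsto_embDensity_H6_blowup halves tendsto_card_halves)
    (h := fun n => 1 / 8 + upperError n) ?_ ?_ ?_
  · have h := tendsto_upperError.const_add (1 / 8)
    rwa [add_zero] at h
  · refine Eventually.of_forall fun n => ?_
    simp only [embDensity, maxEmbDensity, Fintype.card_fin]
    gcongr
    exact Finset.le_sup (f := fun G : SimpleGraph (Fin n) => embCount H6 G) (Finset.mem_univ _)
  · filter_upwards [eventually_ge_atTop 5] with n hn
    obtain ⟨G, -, hG⟩ := Finset.exists_mem_eq_sup (Finset.univ : Finset (SimpleGraph (Fin n)))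
      Finset.univ_nonempty fun G => embCount H6 G
    have h := embDensity_H6_le_add_upperError G (by simpa using hn)
    rw [embDensity, Fintype.card_fin] at h
    rw [maxEmbDensity, maxEmbCount, hG]
    simpa using h

theorem isTight_of_frequently_le_inducedDensity {n : ℕ → ℕ}
    (G : (i : ℕ) → SimpleGraph (Fin (n i))) (hG : IsAlmostExtremal H6 G) (F : SimpleGraph (Fin 5))
    {δ : ℝ} (hδ : 0 < δ) (hF : ∃ᶠ i in atTop, δ ≤ inducedDensity F (G i)) : IsTight F := by
  by_contra hloose
  obtain ⟨hn, c, hc, hlim⟩ := hG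
  rw [tendsto_nhds_unique hc hasSemiInducibilityConstant_H6] at hlim
  -- A non-tight `F` of density at least `δ` lowers the bound by `δ / 120 / 25920`. Half of this is
  -- reserved for the convergence of the densities and half for `upperError`.
  have hδ' : (0 : ℝ) < δ / 120 / 25920 / 2 := by positivity
  have h1 := hlim.eventually_const_lt (sub_lt_self _ hδ')
  have h2 := (tendsto_upperError.comp hn).eventually_lt_const hδ'
  obtain ⟨i, hi, h1, h2, h5⟩ :=
    (hF.and_eventually (h1.and (h2.and (hn.eventually_ge_atTop 5)))).exists
  have h3 := embDensity_H6_le (G i) (by simpa using h5)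
  have h4 := hi.trans (inducedDensity_le F hloose (G i))
  simp only [Function.comp_apply, upperError, Fintype.card_fin] at h2 h3 h4
  linarith

end SemiInducibility

theorem mainTheorem9 :
    SemiInducibility.HasSemiInducibilityConstant SemiInducibility.H6 (1 / 8) ∧
    SemiInducibility.HasFlagCertificate SemiInducibility.H6 5 (1 / 8) ∧
    (∀ part : (n : ℕ) → Fin n → Fin 2,
      (∀ j : Fin 2, Tendsto
        (fun n : ℕ => ((Finset.univ.filter (fun v : Fin n => part n v = j)).card : ℝ) / (n : ℝ))
        atTop (𝓝 (1 / 2))) →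
      Tendsto (fun n : ℕ => SemiInducibility.embDensity SemiInducibility.H6
        (SemiInducibility.blowup (⊤ : SimpleGraph (Fin 2)) (part n))) atTop (𝓝 (1 / 8))) ∧
    (∀ (n : ℕ → ℕ) (G : (i : ℕ) → SimpleGraph (Fin (n i))),
      SemiInducibility.IsAlmostExtremal SemiInducibility.H6 G →
      ∀ F : SimpleGraph (Fin 5),
        (∃ δ : ℝ, 0 < δ ∧ ∃ᶠ i in atTop, δ ≤ SemiInducibility.inducedDensity F (G i)) →
        SemiInducibility.IsCompleteBipartite F ∨
          SemiInducibility.IsCompleteBipartiteAddIsolated F) :=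
  ⟨SemiInducibility.hasSemiInducibilityConstant_H6, SemiInducibility.hasFlagCertificate_H6,
    SemiInducibility.tendsto_embDensity_H6_blowup, fun _ G hG F ⟨_, hδ, hF⟩ =>
      SemiInducibility.isTight_of_frequently_le_inducedDensity G hG F hδ hF⟩
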